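/- Let $K$ be a field of characteristic zero, $\mathfrak u$ a finite-dimensional nilpotent Lie algebra over $K$ of dimension $n$, and $U=\exp(\mathfrak u)$ the corresponding unipotent group. Let $U$ act rationally on an irreducible affine variety $X$ over $K$ with coordinate algebra $\mathcal A=K[X]$, let $(T_gf)(x)=f(g^{-1}x)$ be the induced action on $\mathcal A$ and on $K(X)$, and for $x\in\mathfrak u$ let $D_x=\frac{d}{dt}\big|_{t=0}T_{\exp(tx)}$, a locally nilpotent derivation of $\mathcal A$ and of each localization of $\mathcal A$ at invariant functions. Fix a chain of ideals $\mathfrak u=\mathfrak u_n\supset\mathfrak u_{n-1}\supset\dots\supset\mathfrak u_0=0$ of $\mathfrak u$ with one-dimensional quotients. For an algebra $B$ on which the $D_x$ act, let $B^{\mathfrak u_i}=\{f\in B: D_yf=0 \text{ for all } y\in\mathfrak u_i\}$. Put $i_0=0$, $\mathcal A_0=\mathcal A$. As long as possible, for $k=1,2,\dots$, let $i_k$ be the least number $i$ with $i_{k-1}<i\le n$ and $\mathcal A_{k-1}^{\mathfrak u_{i}}\neq\mathcal A_{k-1}^{\mathfrak u_{i_{k-1}}}$, and choose $x_{i_k}\in\mathfrak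 u_{i_k}\setminus\mathfrak u_{i_k-1}$, $a_{k,1}\in\mathcal A_{k-1}^{\mathfrak u_{i_{k-1}}}$ and $0\ne a_{k,0}\in\mathcal A_{k-1}^{\mathfrak u}$ with $D_{x_{i_k}}(a_{k,1})=a_{k,0}$; let $\mathcal A_k=\mathcal A_{k-1}[a_{k,0}^{-1}]\subset K(X)$. Let $m$ be the number of steps after which no further $i_k$ exists. Put $Q_k=a_{k,1}a_{k,0}^{-1}$, $$S_k(f)=\sum_{j\ge 0}\frac{(-1)^j}{j!}D_{x_{i_k}}^j(f)\,Q_k^j,\qquad P=S_m\circ\cdots\circ S_1 .$$ Let $X_0\subset X$ be the open subset $a_{k,0}\neq0$ $(1\le k\le m)$, so that $K[X_0]=\mathcal A_m$; let $\mathcal S=\{x\in X_0: a_{k,1}(x)=0,\ 1\le k\le m\}$ (points with coordinates in an algebraic closure of $K$), and let $\mathrm{Res}:K[X_0]\to K[\mathcal S]$ be the restriction map. Theorem. Assume that the functions $a_{k,1}$, $1\le k\le m$, generate the defining ideal of $\mathcal S$ in $K[X_0]$. Let $b_1,\dots,b_s\in K[X]$ be such that $\mathrm{Res}(b_1),\dots,\mathrm{Res}(b_s),\mathrm{Res}(a_{1,0})^{\pm1},\dots,\mathrm{Res}(a_{m,0})^{\pm1}$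 generate the $K$-algebra $K[\mathcal S]$. Then $P(b_1),\dots,P(b_s),a_{1,0}^{\pm1},\dots,a_{m,0}^{\pm1}$ generate the $K$-algebra of invariants $K[X_0]^U$. In particular, they generate the field of invariants $K(X)^U$ over $K$. -/

import Mathlib

noncomputable section

/-! ### The unipotent group of a nilpotent Lie algebra -/

/-- The iterated bracket `[a₁, [a₂, [… [aᵣ₋₁, aᵣ] …]]]` of a word; a one-letter word is itself. -/
def nestedBracket {L : Type*} [LieRing L] : List L → L
  | [] => 0
  | [a] => a
  | a :: b :: l => ⁅a, nestedBracket (b :: l)⁆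

/-- The word `x^{r₁} y^{s₁} ⋯ x^{rₙ} y^{sₙ}` in the letters `x` and `y`. -/
def bchWord {L : Type*} (x y : L) {n d : ℕ} (e : Fin n → Fin d × Fin d) : List L :=
  (List.ofFn fun j =>
    List.replicate ((e j).1 : ℕ) x ++ List.replicate ((e j).2 : ℕ) y).flatten

/-- The part with `n, rⱼ, sⱼ ≤ c` of Dynkin's formula
`∑ₙ ((-1)ⁿ⁻¹ / n) ∑ [x^{r₁} y^{s₁} ⋯ x^{rₙ} y^{sₙ}] / ((∑ⱼ (rⱼ + sⱼ)) ∏ⱼ rⱼ! sⱼ!)`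
for `log (exp x · exp y)`, the inner sum over all `(rⱼ, sⱼ) ≠ (0, 0)`. -/
def dynkinSum (K : Type*) {L : Type*} [Field K] [LieRing L] [LieAlgebra K L] (c : ℕ) (x y : L) :
    L :=
  ∑ n ∈ Finset.Icc 1 c, ∑ e : Fin n → Fin (c + 1) × Fin (c + 1),
    if ∀ j, e j ≠ (0, 0) then
      (((-1 : K) ^ (n - 1) / (n : K)) *
        (((∑ j, (((e j).1 : ℕ) + ((e j).2 : ℕ)) : ℕ) : K) *
          ((∏ j, (((e j).1 : ℕ).factorial * ((e j).2 : ℕ).factorial) : ℕ) : K))⁻¹) •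
        nestedBracket (bchWord x y e)
    else 0

/-- The Baker–Campbell–Hausdorff product `log (exp x · exp y)` of a finite-dimensional nilpotent
Lie algebra over a field of characteristic zero. Brackets of more than `dim L` letters vanish, so
Dynkin's formula may be cut off at `dim L`. -/
def bch (K : Type*) {L : Type*} [Field K] [LieRing L] [LieAlgebra K L] (x y : L) : L :=
  dynkinSum K (Module.finrank K L) x y

/-- The group `U = exp L` of a finite-dimensional nilpotent Lie algebra `L` over a field of
characteristic zero: its elements are the `exp x` for `x` in `L`, with
`exp x * exp y = exp (bch x y)`. (The unit is `exp 0`, the inverse of `exp x` is `exp (-x)`.) -/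
structure ExpGroup (K L : Type*) [Field K] [LieRing L] [LieAlgebra K L] where
  /-- the element `exp x` -/
  exp ::
  /-- the inverse of the exponential map -/
  log : L

instance (K L : Type*) [Field K] [LieRing L] [LieAlgebra K L] : Mul (ExpGroup K L) :=
  ⟨fun g h => ExpGroup.exp (bch K g.log h.log)⟩

/-! ### Rational actions on an affine variety and their differentials

An irreducible affine variety `X` over `K` is given by its coordinate algebra `A = K[X]`, a finitely
generated `K`-algebra that is a domain; `FractionRing A` is the field `K(X)`. An action of `U` on
`X` is given by the automorphisms `T g` of `K[X]` with `(T g f)(x) = f (g⁻¹ x)`. A multiplicative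
map between groups is a homomorphism of groups. -/

section Action

variable {K L A : Type*} [Field K] [LieRing L] [LieAlgebra K L]
  [CommRing A] [IsDomain A] [Algebra K A]

/-- The action is rational (algebraic): for each regular function `f` the function `T (exp x) f`
depends polynomially on `x`, that is, it is given by an element of `K[L] ⊗ A`, written as a
polynomial in the linear forms on `L` with coefficients in `A`. -/
def IsRationalAction (T : ExpGroup K L →ₙ* (A ≃ₐ[K] A)) : Prop :=
  ∀ f : A, ∃ p : MvPolynomial (Module.Dual K L) A,
    ∀ x : L, T (ExpGroup.exp x) f = MvPolynomial.eval (fun φ => algebraMap K A (φ x)) p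

/-- The action of `g` on the field `K(X)`, extending the automorphism `T g` of `K[X]`. -/
def ratAct (T : ExpGroup K L →ₙ* (A ≃ₐ[K] A)) (g : ExpGroup K L) :
    FractionRing A ≃ₐ[K] FractionRing A :=
  IsFractionRing.fieldEquivOfAlgEquiv K (FractionRing A) (FractionRing A) (T g)

open Classical in
/-- The operator `D_x`, the differential of the action at the unit in the direction `x`: the
coefficient of `t` in the polynomial `exp (t x) f`. It is meant for those `f` for which
`t ↦ exp (t x) f` is polynomial, as it is on `K[X]` and on its localizations at invariant
functions (elsewhere it takes the value `0`). -/
def lieDeriv (T : ExpGroup K L →ₙ* (A ≃ₐ[K] A)) (x : L) (f : FractionRing A) : FractionRing A :=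
  if h : ∃ q : Polynomial (FractionRing A), ∀ t : K,
      ratAct T (ExpGroup.exp (t • x)) f = q.eval (algebraMap K (FractionRing A) t)
  then h.choose.coeff 1 else 0

/-- The subalgebra `A_k` of `K(X)`: the localization of `K[X]` at `a_{1,0}, …, a_{k,0}`. -/
def locAlg (K : Type*) {A : Type*} [Field K] [CommRing A] [IsDomain A] [Algebra K A]
    (a0 : ℕ → FractionRing A) (k : ℕ) : Subalgebra K (FractionRing A) :=
  Algebra.adjoin K (Set.range (algebraMap A (FractionRing A)) ∪
    {f | ∃ j, 1 ≤ j ∧ j ≤ k ∧ f = (a0 j)⁻¹})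

/-- The invariants `A_k^I` in `A_k` of an ideal `I` of the Lie algebra. -/
def lieInvariants (T : ExpGroup K L →ₙ* (A ≃ₐ[K] A)) (a0 : ℕ → FractionRing A) (k : ℕ)
    (I : LieIdeal K L) : Set (FractionRing A) :=
  {f | f ∈ locAlg K a0 k ∧ ∀ y ∈ I, lieDeriv T y f = 0}

/-- The choices made in the construction of a `U`-projector in `m` steps. The entries `index k`,
`x k`, `a0 k`, `a1 k` matter for `1 ≤ k ≤ m` only (and `index 0 = 0`). -/
structure ProjectorData (T : ExpGroup K L →ₙ* (A ≃ₐ[K] A)) (m : ℕ) where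
  /-- the ideals `L_0 ⊂ L_1 ⊂ … ⊂ L_n` with `n = dim L` -/
  chain : ℕ → LieIdeal K L
  chain_zero : chain 0 = ⊥
  chain_top : chain (Module.finrank K L) = ⊤
  chain_le : ∀ i < Module.finrank K L, chain i ≤ chain (i + 1)
  chain_codim : ∀ i < Module.finrank K L,
    Module.finrank K (chain (i + 1)) = Module.finrank K (chain i) + 1
  /-- the numbers `0 = i_0 < i_1 < … < i_m ≤ n` -/
  index : ℕ → ℕ
  /-- the elements `x_{i_k}` -/
  x : ℕ → L
  /-- the functions `a_{k,0}` -/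
  a0 : ℕ → FractionRing A
  /-- the functions `a_{k,1}` -/
  a1 : ℕ → FractionRing A
  index_zero : index 0 = 0
  /-- `i_{k+1}` is the least number beyond `i_k` at which the invariants in `A_k` change -/
  index_least : ∀ k < m, IsLeast {i | index k < i ∧ i ≤ Module.finrank K L ∧
    lieInvariants T a0 k (chain i) ≠ lieInvariants T a0 k (chain (index k))} (index (k + 1))
  x_mem : ∀ k < m, x (k + 1) ∈ chain (index (k + 1))
  x_notMem : ∀ k < m, x (k + 1) ∉ chain (index (k + 1) - 1)
  a1_mem : ∀ k < m, a1 (k + 1) ∈ lieInvariants T a0 k (chain (index k))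
  a0_mem : ∀ k < m, a0 (k + 1) ∈ lieInvariants T a0 k ⊤
  a0_ne_zero : ∀ k < m, a0 (k + 1) ≠ 0
  lieDeriv_a1 : ∀ k < m, lieDeriv T (x (k + 1)) (a1 (k + 1)) = a0 (k + 1)
  /-- the construction stops at `i_m`: the invariants in `A_m` do not change any more -/
  stop_at : ∀ i, index m ≤ i → i ≤ Module.finrank K L →
    lieInvariants T a0 m (chain i) = lieInvariants T a0 m (chain (index m))

/-- `S(f) = f - D_x(f) Q + D_x²(f) Q² / 2! - ⋯` -/
def sliceMap (T : ExpGroup K L →ₙ* (A ≃ₐ[K] A)) (x : L) (Q f : FractionRing A) :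
    FractionRing A :=
  ∑ᶠ j : ℕ, ((-1 : K) ^ j / (j.factorial : K)) • ((lieDeriv T x)^[j] f * Q ^ j)

end Action

namespace ProjectorData

variable {K L A : Type*} [Field K] [LieRing L] [LieAlgebra K L]
  [CommRing A] [IsDomain A] [Algebra K A] {T : ExpGroup K L →ₙ* (A ≃ₐ[K] A)} {m : ℕ}

/-- The composition `S_k ∘ ⋯ ∘ S_1`, where `S_k` is formed with `x_{i_k}` and
`Q_k = a_{k,1} / a_{k,0}`. -/
def partialProjector (d : ProjectorData T m) : ℕ → FractionRing A → FractionRing A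
  | 0 => id
  | k + 1 => sliceMap T (d.x (k + 1)) (d.a1 (k + 1) / d.a0 (k + 1)) ∘ d.partialProjector k

/-- The `U`-projector `P = S_m ∘ ⋯ ∘ S_1` on `K[X]`. -/
def projector (d : ProjectorData T m) (f : A) : FractionRing A :=
  d.partialProjector m (algebraMap A (FractionRing A) f)

/-- The algebra `K[X₀]` of the open subset `X₀` of `X` where `a_{1,0}, …, a_{m,0}` do not vanish. -/
def openAlg (d : ProjectorData T m) : Subalgebra K (FractionRing A) := locAlg K d.a0 m

theorem locAlg_mono {a0 : ℕ → FractionRing A} {k l : ℕ} (h : k ≤ l) :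
    locAlg K a0 k ≤ locAlg K a0 l := by
  refine Algebra.adjoin_mono (Set.union_subset_union_right _ ?_)
  rintro f ⟨j, h1, h2, rfl⟩
  exact ⟨j, h1, h2.trans h, rfl⟩

theorem algebraMap_mem_openAlg (d : ProjectorData T m) (f : A) :
    algebraMap A (FractionRing A) f ∈ d.openAlg :=
  Algebra.subset_adjoin (Or.inl ⟨f, rfl⟩)

theorem a0_mem_openAlg (d : ProjectorData T m) (k : Fin m) : d.a0 (k + 1) ∈ d.openAlg :=
  locAlg_mono k.2.le (d.a0_mem k k.2).1

theorem a0_inv_mem_openAlg (d : ProjectorData T m) (k : Fin m) : (d.a0 (k + 1))⁻¹ ∈ d.openAlg :=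
  Algebra.subset_adjoin (Or.inr ⟨k + 1, by omega, by omega, rfl⟩)

theorem a1_mem_openAlg (d : ProjectorData T m) (k : Fin m) : d.a1 (k + 1) ∈ d.openAlg :=
  locAlg_mono k.2.le (d.a1_mem k k.2).1

/-- `a_{k,0}` as a regular function on `X₀`. -/
def a0Reg (d : ProjectorData T m) (k : Fin m) : d.openAlg := ⟨_, d.a0_mem_openAlg k⟩

/-- `a_{k,0}⁻¹` as a regular function on `X₀`. -/
def a0InvReg (d : ProjectorData T m) (k : Fin m) : d.openAlg := ⟨_, d.a0_inv_mem_openAlg k⟩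

/-- `a_{k,1}` as a regular function on `X₀`. -/
def a1Reg (d : ProjectorData T m) (k : Fin m) : d.openAlg := ⟨_, d.a1_mem_openAlg k⟩

/-- A regular function on `X` as a regular function on `X₀`. -/
def toOpen (d : ProjectorData T m) (f : A) : d.openAlg := ⟨_, d.algebraMap_mem_openAlg f⟩

/-- The subset `S` of `X₀` where all `a_{k,1}` vanish. A point of `X₀` has its coordinates in an
algebraic closure of `K`: it is a homomorphism from `K[X₀]` to that field. -/
def zeroSet (d : ProjectorData T m) : Set (d.openAlg →ₐ[K] AlgebraicClosure K) :=
  {p | ∀ k, p (d.a1Reg k) = 0}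

/-- The restriction map from `K[X₀]` to the functions on `S`. Its kernel is the defining ideal of
`S` in `K[X₀]`, and its range is the algebra `K[S]` of regular functions on `S`. -/
def res (d : ProjectorData T m) : d.openAlg →ₐ[K] (d.zeroSet → AlgebraicClosure K) :=
  AlgHom.pi fun p => p.1

/-- The functions `P(b_1), …, P(b_s)` and `a_{1,0}, a_{1,0}⁻¹, …, a_{m,0}, a_{m,0}⁻¹`. -/
def generators (d : ProjectorData T m) {s : ℕ} (b : Fin s → A) : Set (FractionRing A) :=
  Set.range (fun i => d.projector (b i)) ∪ Set.range (fun k : Fin m => d.a0 (k + 1)) ∪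
    Set.range (fun k : Fin m => (d.a0 (k + 1))⁻¹)

end ProjectorData

end

noncomputable section

section Dynkin

variable {K L L' : Type*} [Field K] [LieRing L] [LieAlgebra K L] [LieRing L'] [LieAlgebra K L']

theorem map_nestedBracket (f : L →ₗ[K] L') (hf : ∀ a b, f ⁅a, b⁆ = ⁅f a, f b⁆) (l : List L) :
    f (nestedBracket l) = nestedBracket (l.map f) := by
  fun_induction nestedBracket l with
  | case1 => simp [nestedBracket]
  | case2 a => simp [nestedBracket]
  | case3 a b l ih => simp_all [nestedBracket]

theorem map_dynkinSum (f : L →ₗ[K] L') (hf : ∀ a b, f ⁅a, b⁆ = ⁅f a, f b⁆) (c : ℕ) (x y : L) :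
    f (dynkinSum K c x y) = dynkinSum K c (f x) (f y) := by
  simp only [dynkinSum, map_sum]
  refine Finset.sum_congr rfl fun n _ => Finset.sum_congr rfl fun e _ => ?_
  split_ifs with h
  · rw [map_smul, map_nestedBracket f hf]
    congr 2
    simp [bchWord, List.map_flatten, List.map_ofFn, Function.comp_def]
  · simp

theorem nestedBracket_of_multiples (x : L) (l : List L) (hl : ∀ a ∈ l, ∃ r : K, a = r • x) :
    (∃ r : K, nestedBracket l = r • x) ∧ (2 ≤ l.length → nestedBracket l = 0) := by
  fun_induction nestedBracket l with
  | case1 => exact ⟨⟨0, by simp⟩, by simp⟩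
  | case2 a => exact ⟨hl a (by simp), by simp⟩
  | case3 a b l ih =>
    obtain ⟨r, hr⟩ := (ih fun c hc => hl c (List.mem_cons_of_mem _ hc)).1
    obtain ⟨r', hr'⟩ := hl a (by simp)
    have h : ⁅a, nestedBracket (b :: l)⁆ = 0 := by rw [hr, hr']; simp
    exact ⟨⟨0, by simp [h]⟩, fun _ => h⟩

theorem length_bchWord {L : Type*} (x y : L) {n d : ℕ} (e : Fin n → Fin d × Fin d) :
    (bchWord x y e).length = ∑ j, (((e j).1 : ℕ) + ((e j).2 : ℕ)) := by
  simp [bchWord, List.length_flatten, List.map_ofFn, Function.comp_def, List.sum_ofFn]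

theorem nestedBracket_bchWord_smul (x : L) (s t : K) {n d : ℕ} (e : Fin n → Fin d × Fin d)
    (h : 2 ≤ ∑ j, (((e j).1 : ℕ) + ((e j).2 : ℕ))) :
    nestedBracket (bchWord (s • x) (t • x) e) = 0 := by
  refine (nestedBracket_of_multiples (K := K) x _ ?_).2 (by rwa [length_bchWord])
  intro a ha
  simp only [bchWord, List.mem_flatten, List.mem_ofFn] at ha
  obtain ⟨_, ⟨j, rfl⟩, ha⟩ := ha
  rcases List.mem_append.1 ha with ha | ha
  · exact ⟨s, List.eq_of_mem_replicate ha⟩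
  · exact ⟨t, List.eq_of_mem_replicate ha⟩

theorem dynkinSum_smul_smul {c : ℕ} (hc : 1 ≤ c) (x : L) (s t : K) :
    dynkinSum K c (s • x) (t • x) = (s + t) • x := by
  rw [dynkinSum, Finset.sum_eq_single_of_mem 1 (by simp [hc])]
  · rw [← (Equiv.funUnique (Fin 1) (Fin (c + 1) × Fin (c + 1))).symm.sum_comp]
    have h01 : ((1 : Fin (c + 1)), (0 : Fin (c + 1))) ≠ (0, 1) := by
      have : ((1 : Fin (c + 1))) ≠ 0 := by
        rw [Ne, Fin.ext_iff]; simp [Nat.mod_eq_of_lt (show 1 < c + 1 by omega)]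
      simp [this]
    have v1 : ((1 : Fin (c + 1)) : ℕ) = 1 := by
      simp [Nat.mod_eq_of_lt (show 1 < c + 1 by omega)]
    have n1 : (1 : Fin (c + 1)) ≠ 0 := by rw [Ne, Fin.ext_iff, v1]; simp
    rw [Finset.sum_eq_add_of_mem (1, 0) (0, 1) (Finset.mem_univ _) (Finset.mem_univ _) h01]
    · simp [n1, Nat.mod_eq_of_lt (show 1 < c + 1 by omega), bchWord, nestedBracket, add_smul]
    · rintro ⟨p, q⟩ - ⟨h1, h2⟩
      split_ifs with h
      · rw [nestedBracket_bchWord_smul, smul_zero]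
        have h0 := h 0
        simp only [Equiv.funUnique_symm_apply, uniqueElim_const, ne_eq, Prod.mk.injEq,
          Fin.ext_iff, v1, Fin.val_zero, Fintype.sum_unique] at h0 h1 h2 ⊢
        omega
      · rfl
  · intro n hn hn1
    refine Finset.sum_eq_zero fun e _ => ?_
    split_ifs with h
    · rw [nestedBracket_bchWord_smul, smul_zero]
      have hle : ∑ j : Fin n, 1 ≤ ∑ j, (((e j).1 : ℕ) + ((e j).2 : ℕ)) := by
        refine Finset.sum_le_sum fun j _ => ?_
        by_contra hj
        refine h j (Prod.ext (Fin.ext ?_) (Fin.ext ?_)) <;> simp only [Fin.val_zero] <;> omega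
      simp only [Finset.sum_const, Finset.card_univ, Fintype.card_fin, smul_eq_mul] at hle
      have := (Finset.mem_Icc.1 hn).1
      omega
    · rfl

variable [FiniteDimensional K L]

theorem bch_smul_smul (x : L) (s t : K) : bch K (s • x) (t • x) = (s + t) • x := by
  rcases Nat.eq_zero_or_pos (Module.finrank K L) with h | h
  · have := Module.finrank_zero_iff.1 h
    exact Subsingleton.elim _ _
  · exact dynkinSum_smul_smul h x s t

theorem bch_sub_mem_of_sub_mem (I : LieIdeal K L) {x y : L} {s t : K} (z : L)
    (hx : x - s • z ∈ I) (hy : y - t • z ∈ I) : bch K x y - (s + t) • z ∈ I := by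
  rcases Nat.eq_zero_or_pos (Module.finrank K L) with h | h
  · have := Module.finrank_zero_iff.1 h
    rw [Subsingleton.elim (bch K x y - (s + t) • z) 0]
    exact I.zero_mem
  · let f : L →ₗ[K] L ⧸ I := (LieSubmodule.Quotient.mk' I : L →ₗ[K] L ⧸ I)
    have hf : ∀ a, f a = 0 ↔ a ∈ I := fun a => LieSubmodule.Quotient.mk_eq_zero I
    rw [← hf, map_sub, sub_eq_zero] at hx hy ⊢
    rw [bch, map_dynkinSum f fun a b => LieSubmodule.Quotient.mk_bracket I a b, hx, hy]
    simp only [map_smul]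
    exact dynkinSum_smul_smul h _ s t

theorem bch_neg_mem (I : LieIdeal K L) {x y : L} (h : y - x ∈ I) : bch K (-x) y ∈ I := by
  simpa using bch_sub_mem_of_sub_mem I (x := -x) (y := y) (s := -1) (t := 1) x
    (by simp) (by simpa using h)

theorem bch_sub_mem (I : LieIdeal K L) (x : L) {y : L} (h : y ∈ I) : bch K y x - x ∈ I := by
  simpa using bch_sub_mem_of_sub_mem I (x := y) (y := x) (s := 0) (t := 1) x
    (by simpa using h) (by simp)

end Dynkin

section RatAct

variable {K L A : Type*} [Field K] [LieRing L] [LieAlgebra K L] [CommRing A] [IsDomain A]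
  [Algebra K A] (T : ExpGroup K L →ₙ* (A ≃ₐ[K] A))

theorem ratAct_algebraMap (g : ExpGroup K L) (a : A) :
    ratAct T g (algebraMap A (FractionRing A) a) = algebraMap A (FractionRing A) (T g a) := by
  simp [ratAct, IsFractionRing.fieldEquivOfAlgEquiv]

theorem ratAct_mul (g h : ExpGroup K L) (f : FractionRing A) :
    ratAct T (g * h) f = ratAct T g (ratAct T h f) := by
  obtain ⟨x, y, -, rfl⟩ := IsFractionRing.div_surjective A f
  simp [ratAct_algebraMap]

theorem ratAct_exp_exp (x y : L) (f : FractionRing A) :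
    ratAct T (.exp x) (ratAct T (.exp y) f) = ratAct T (.exp (bch K x y)) f :=
  (ratAct_mul T _ _ f).symm

/-- `f` is fixed by the subgroup `exp I` of `exp L`. -/
def FixedBy (I : LieIdeal K L) (f : FractionRing A) : Prop :=
  ∀ y ∈ I, ratAct T (.exp y) f = f

theorem fixedBy_top {T : ExpGroup K L →ₙ* (A ≃ₐ[K] A)} {f : FractionRing A} :
    FixedBy T (⊤ : LieIdeal K L) f ↔ ∀ g, ratAct T g f = f :=
  ⟨fun h g => h g.log (LieSubmodule.mem_top _), fun h _ _ => h _⟩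

variable [FiniteDimensional K L]

theorem ratAct_exp_smul_smul (x : L) (s t : K) (f : FractionRing A) :
    ratAct T (.exp (s • x)) (ratAct T (.exp (t • x)) f) = ratAct T (.exp ((s + t) • x)) f := by
  rw [ratAct_exp_exp, bch_smul_smul]

theorem ratAct_exp_zero (f : FractionRing A) : ratAct T (.exp (0 : L)) f = f := by
  have h := ratAct_exp_smul_smul T (0 : L) 0 0 f
  simp only [smul_zero] at h
  exact (ratAct T (.exp (0 : L))).injective h

theorem ratAct_exp_neg (x : L) (f : FractionRing A) :
    ratAct T (.exp x) (ratAct T (.exp (-x)) f) = f := by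
  simpa [ratAct_exp_zero] using ratAct_exp_smul_smul T x 1 (-1) f

variable {T}

theorem fixedBy_bot (f : FractionRing A) : FixedBy T (⊥ : LieIdeal K L) f := by
  intro y hy
  rw [(LieSubmodule.mem_bot y).1 hy, ratAct_exp_zero]

/-- `exp I` is a normal subgroup of `exp L`. -/
theorem FixedBy.ratAct {I : LieIdeal K L} {f : FractionRing A} (h : FixedBy T I f) (x : L) :
    FixedBy T I (ratAct T (.exp x) f) := by
  intro y hy
  have h1 := h _ (bch_neg_mem I (bch_sub_mem I x hy))
  rw [← ratAct_exp_exp, ← ratAct_exp_exp] at h1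
  have h2 := congrArg (_root_.ratAct T (.exp x)) h1
  rwa [ratAct_exp_neg] at h2

/-- `exp I` is generated by `exp J` and the `exp (t x)` if `I = J + K x`. -/
theorem FixedBy.of_le_sup {I J : LieIdeal K L} {f : FractionRing A} (h : FixedBy T J f) {x : L}
    (hx : ∀ t : K, _root_.ratAct T (.exp (t • x)) f = f) (hI : ∀ y ∈ I, ∃ t : K, y - t • x ∈ J) :
    FixedBy T I f := by
  intro y hy
  obtain ⟨t, ht⟩ := hI y hy
  have h1 := h _ (bch_neg_mem J ht)
  rw [← ratAct_exp_exp] at h1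
  have h2 := congrArg (_root_.ratAct T (.exp (t • x))) h1
  rwa [ratAct_exp_neg, hx] at h2

end RatAct

section OrbitPolynomial

open Polynomial

variable {K L A : Type*} [Field K] [LieRing L] [LieAlgebra K L] [CommRing A] [IsDomain A]
  [Algebra K A]

/-- The polynomial `q` describes the orbit map `t ↦ exp (t x) f`. -/
def IsOrbitPoly (T : ExpGroup K L →ₙ* (A ≃ₐ[K] A)) (x : L) (f : FractionRing A)
    (q : (FractionRing A)[X]) : Prop :=
  ∀ t : K, ratAct T (.exp (t • x)) f = q.eval (algebraMap K (FractionRing A) t)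

theorem eq_of_forall_eval_algebraMap {K F : Type*} [Field K] [CharZero K] [Field F] [Algebra K F]
    {p q : F[X]} (h : ∀ t : K, p.eval (algebraMap K F t) = q.eval (algebraMap K F t)) : p = q := by
  refine eq_of_infinite_eval_eq p q (Set.Infinite.mono ?_
    (Set.infinite_range_of_injective (algebraMap K F).injective))
  rintro _ ⟨t, rfl⟩
  exact h t

theorem eval_mem_of_coeff_mem {K F : Type*} [Field K] [Field F] [Algebra K F] {B : Subalgebra K F}
    {q : F[X]}
    (hq : ∀ i, q.coeff i ∈ B) {z : F} (hz : z ∈ B) : q.eval z ∈ B := by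
  rw [eval_eq_sum_range]
  exact Subalgebra.sum_mem _ fun i _ => B.mul_mem (hq i) (B.pow_mem hz i)

namespace IsOrbitPoly

variable {T : ExpGroup K L →ₙ* (A ≃ₐ[K] A)} {x : L} {f g Q : FractionRing A}
  {p q : (FractionRing A)[X]}

theorem add (hf : IsOrbitPoly T x f p) (hg : IsOrbitPoly T x g q) :
    IsOrbitPoly T x (f + g) (p + q) := fun t => by rw [map_add, hf, hg, eval_add]

theorem mul (hf : IsOrbitPoly T x f p) (hg : IsOrbitPoly T x g q) :
    IsOrbitPoly T x (f * g) (p * q) := fun t => by rw [map_mul, hf, hg, eval_mul]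

theorem const (h : ∀ t : K, ratAct T (.exp (t • x)) f = f) : IsOrbitPoly T x f (C f) :=
  fun t => by rw [h, eval_C]

theorem algebraMap_left (c : K) :
    IsOrbitPoly T x (algebraMap K (FractionRing A) c) (C (algebraMap K (FractionRing A) c)) :=
  const fun t => by simp

theorem eval_zero [FiniteDimensional K L] (h : IsOrbitPoly T x f q) : q.eval 0 = f := by
  simpa [ratAct_exp_zero] using (h 0).symm

theorem coeff_zero [FiniteDimensional K L] (h : IsOrbitPoly T x f q) : q.coeff 0 = f := by
  rw [coeff_zero_eq_eval_zero, h.eval_zero]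

variable [CharZero K]

theorem unique (hp : IsOrbitPoly T x f p) (hq : IsOrbitPoly T x f q) : p = q :=
  eq_of_forall_eval_algebraMap fun t => by rw [← hp, ← hq]

theorem lieDeriv_eq (h : IsOrbitPoly T x f q) : lieDeriv T x f = q.coeff 1 := by
  have h' : ∃ q : (FractionRing A)[X], ∀ t : K,
      ratAct T (.exp (t • x)) f = q.eval (algebraMap K (FractionRing A) t) := ⟨q, h⟩
  rw [lieDeriv, dif_pos h', unique (T := T) (x := x) h'.choose_spec h]

theorem map_ratAct_of_fixedBy [FiniteDimensional K L] {I : LieIdeal K L}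
    (h : IsOrbitPoly T x f q) (hf : FixedBy T I f) {y : L} (hy : y ∈ I) :
    q.map (ratAct T (.exp y) : FractionRing A →+* FractionRing A) = q := by
  refine eq_of_forall_eval_algebraMap (K := K) fun t => ?_
  have h1 := hf.ratAct (t • x) y hy
  rw [h] at h1
  conv_rhs => rw [← h1]
  have h2 : algebraMap K (FractionRing A) t = (ratAct T (.exp y) :
      FractionRing A →+* FractionRing A) (algebraMap K (FractionRing A) t) := by simp
  conv_lhs => rw [h2, eval_map_apply]
  rfl

variable [FiniteDimensional K L]

theorem map_ratAct (h : IsOrbitPoly T x f q) (s : K) :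
    q.map (ratAct T (.exp (s • x)) : FractionRing A →+* FractionRing A) =
      taylor (algebraMap K (FractionRing A) s) q := by
  refine eq_of_forall_eval_algebraMap (K := K) fun t => ?_
  have h1 := ratAct_exp_smul_smul T x s t f
  rw [h, h] at h1
  have h2 : algebraMap K (FractionRing A) t = (ratAct T (.exp (s • x)) :
      FractionRing A →+* FractionRing A) (algebraMap K (FractionRing A) t) := by simp
  rw [taylor_eval, ← map_add, add_comm t s, ← h1]
  conv_lhs => rw [h2, eval_map_apply]
  rfl

theorem derivative (h : IsOrbitPoly T x f q) :
    IsOrbitPoly T x (lieDeriv T x f) (Polynomial.derivative q) := fun s => by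
  rw [h.lieDeriv_eq, ← taylor_coeff_one, ← h.map_ratAct, coeff_map]
  rfl

theorem iterate_derivative (h : IsOrbitPoly T x f q) (j : ℕ) :
    IsOrbitPoly T x ((lieDeriv T x)^[j] f) (Polynomial.derivative^[j] q) := by
  induction j with
  | zero => exact h
  | succ j ih =>
    rw [Function.iterate_succ_apply', Function.iterate_succ_apply']
    exact ih.derivative

theorem iterate_lieDeriv_eq (h : IsOrbitPoly T x f q) (j : ℕ) :
    (lieDeriv T x)^[j] f = j.factorial • q.coeff j := by
  rw [← (h.iterate_derivative j).coeff_zero, coeff_iterate_derivative, zero_add,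
    Nat.descFactorial_self]

theorem sliceMap_eq (h : IsOrbitPoly T x f q) : sliceMap T x Q f = q.eval (-Q) := by
  have hterm : ∀ j : ℕ, ((-1 : K) ^ j / (j.factorial : K)) • ((lieDeriv T x)^[j] f * Q ^ j) =
      q.coeff j * (-Q) ^ j := fun j => by
    have hj : (j.factorial : FractionRing A) ≠ 0 := by
      have := (algebraMap K (FractionRing A)).injective.ne
        (Nat.cast_ne_zero (R := K).2 j.factorial_ne_zero)
      simpa using this
    rw [h.iterate_lieDeriv_eq, Algebra.smul_def, neg_pow Q, nsmul_eq_mul]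
    simp only [map_div₀, map_pow, map_neg, map_one, map_natCast]
    field_simp
  rw [sliceMap, finsum_congr hterm, eval_eq_sum_range, finsum_eq_sum_of_support_subset]
  intro j hj
  have : q.coeff j ≠ 0 := left_ne_zero_of_mul hj
  simpa [Nat.lt_succ_iff] using le_natDegree_of_ne_zero this

theorem eq_C_of_lieDeriv_eq_zero (h : IsOrbitPoly T x f q) (h0 : lieDeriv T x f = 0) :
    q = C f := by
  have h1 := h.derivative
  rw [h0] at h1
  have h2 : Polynomial.derivative q = 0 :=
    h1.unique fun t => by simp
  have : CharZero (FractionRing A) :=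
    charZero_of_injective_algebraMap (algebraMap K (FractionRing A)).injective
  rw [eq_C_of_derivative_eq_zero h2, h.coeff_zero]

theorem ratAct_eq_of_lieDeriv_eq_zero (h : IsOrbitPoly T x f q) (h0 : lieDeriv T x f = 0) (t : K) :
    ratAct T (.exp (t • x)) f = f := by
  rw [h, h.eq_C_of_lieDeriv_eq_zero h0, eval_C]

theorem ratAct_eq_add (h : IsOrbitPoly T x f q) (h0 : lieDeriv T x (lieDeriv T x f) = 0) (t : K) :
    ratAct T (.exp (t • x)) f =
      f + algebraMap K (FractionRing A) t * lieDeriv T x f := by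
  have h1 := h.derivative.eq_C_of_lieDeriv_eq_zero h0
  have : CharZero (FractionRing A) :=
    charZero_of_injective_algebraMap (algebraMap K (FractionRing A)).injective
  have h2 : Polynomial.derivative (q - C (lieDeriv T x f) * X) = 0 := by simp [h1]
  have h3 := eq_C_of_derivative_eq_zero h2
  rw [sub_eq_iff_eq_add] at h3
  rw [h, h3, eval_add, eval_C, eval_mul, eval_C, eval_X, coeff_sub, coeff_C_mul, coeff_X_zero,
    mul_zero, sub_zero, h.coeff_zero, mul_comm]

theorem ratAct_sliceMap (h : IsOrbitPoly T x f q) (hQ : ∀ t : K, ratAct T (.exp (t • x)) Q =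
    Q + algebraMap K (FractionRing A) t) (s : K) :
    ratAct T (.exp (s • x)) (sliceMap T x Q f) = sliceMap T x Q f := by
  rw [h.sliceMap_eq]
  have h1 := eval_map_apply (ratAct T (.exp (s • x)) : FractionRing A →+* FractionRing A) (p := q)
    (-Q)
  rw [h.map_ratAct, taylor_eval] at h1
  refine Eq.trans h1.symm ?_
  congr 1
  simp [hQ]

theorem fixedBy_sliceMap {I : LieIdeal K L} (h : IsOrbitPoly T x f q) (hf : FixedBy T I f)
    (hQ : FixedBy T I Q) : FixedBy T I (sliceMap T x Q f) := by
  intro y hy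
  rw [h.sliceMap_eq]
  have h1 := eval_map_apply (ratAct T (.exp y) : FractionRing A →+* FractionRing A) (p := q) (-Q)
  rw [h.map_ratAct_of_fixedBy hf hy] at h1
  refine Eq.trans h1.symm ?_
  congr 1
  simp [hQ y hy]

end IsOrbitPoly

/-- The orbit maps `t ↦ exp (t x) f` of all elements `f` of `B` are polynomial, with coefficients
in `B`. -/
def HasOrbitPolys (T : ExpGroup K L →ₙ* (A ≃ₐ[K] A)) (B : Subalgebra K (FractionRing A)) : Prop :=
  ∀ f ∈ B, ∀ x : L, ∃ q : (FractionRing A)[X], (∀ i, q.coeff i ∈ B) ∧ IsOrbitPoly T x f q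

variable {T : ExpGroup K L →ₙ* (A ≃ₐ[K] A)}

theorem exists_isOrbitPoly_algebraMap (hT : IsRationalAction T) (x : L) (a : A) :
    ∃ q : A[X], IsOrbitPoly T x (algebraMap A (FractionRing A) a)
      (q.map (algebraMap A (FractionRing A))) := by
  obtain ⟨p, hp⟩ := hT a
  refine ⟨MvPolynomial.eval₂Hom C (fun φ => C (algebraMap K A (φ x)) * X) p, fun t => ?_⟩
  rw [ratAct_algebraMap, hp, IsScalarTower.algebraMap_apply K A (FractionRing A), eval_map_apply]
  congr 1
  clear hp
  induction p using MvPolynomial.induction_on with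
  | C r => simp
  | add p q hp hq => rw [map_add, map_add, eval_add, hp, hq]
  | mul_X p φ hp =>
    rw [map_mul, map_mul, eval_mul, ← hp]
    congr 1
    rw [MvPolynomial.eval_X, MvPolynomial.coe_eval₂Hom, MvPolynomial.eval₂_X, eval_mul, eval_C,
      eval_X, map_smul, smul_eq_mul, map_mul, mul_comm]

theorem hasOrbitPolys_adjoin {s : Set (FractionRing A)} (h : ∀ f ∈ s, ∀ x : L,
    ∃ q : (FractionRing A)[X], (∀ i, q.coeff i ∈ Algebra.adjoin K s) ∧ IsOrbitPoly T x f q) :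
    HasOrbitPolys T (Algebra.adjoin K s) := by
  intro f hf x
  induction hf using Algebra.adjoin_induction with
  | mem f hf => exact h f hf x
  | algebraMap c =>
    refine ⟨C (algebraMap K _ c), fun i => ?_, .algebraMap_left c⟩
    rw [coeff_C]
    split_ifs
    · exact Subalgebra.algebraMap_mem _ _
    · exact Subalgebra.zero_mem _
  | add f g _ _ hf hg =>
    obtain ⟨p, hp, hp'⟩ := hf
    obtain ⟨q, hq, hq'⟩ := hg
    refine ⟨p + q, fun i => ?_, hp'.add hq'⟩
    rw [coeff_add]
    exact Subalgebra.add_mem _ (hp i) (hq i)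
  | mul f g _ _ hf hg =>
    obtain ⟨p, hp, hp'⟩ := hf
    obtain ⟨q, hq, hq'⟩ := hg
    refine ⟨p * q, fun i => ?_, hp'.mul hq'⟩
    rw [coeff_mul]
    exact Subalgebra.sum_mem _ fun _ _ => Subalgebra.mul_mem _ (hp _) (hq _)

theorem hasOrbitPolys_locAlg (hT : IsRationalAction T) {a0 : ℕ → FractionRing A} {k : ℕ}
    (h : ∀ j, 1 ≤ j → j ≤ k → ∀ g, ratAct T g (a0 j) = a0 j) : HasOrbitPolys T (locAlg K a0 k) := by
  refine hasOrbitPolys_adjoin ?_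
  rintro _ (⟨a, rfl⟩ | ⟨j, h1, h2, rfl⟩) x
  · obtain ⟨q, hq⟩ := exists_isOrbitPoly_algebraMap hT x a
    refine ⟨_, fun i => ?_, hq⟩
    rw [coeff_map]
    exact Algebra.subset_adjoin (Or.inl ⟨_, rfl⟩)
  · refine ⟨C (a0 j)⁻¹, fun i => ?_, .const fun t => by rw [map_inv₀, h j h1 h2]⟩
    rw [coeff_C]
    split_ifs
    · exact Algebra.subset_adjoin (Or.inr ⟨j, h1, h2, rfl⟩)
    · exact Subalgebra.zero_mem _

variable [CharZero K]

theorem lieDeriv_eq_zero_of_fixed {x : L} {f : FractionRing A}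
    (h : ∀ t : K, ratAct T (.exp (t • x)) f = f) : lieDeriv T x f = 0 := by
  rw [(IsOrbitPoly.const h).lieDeriv_eq, coeff_C_succ]

variable [FiniteDimensional K L]

theorem sliceMap_eq_self {x : L} {Q f : FractionRing A}
    (h : ∀ t : K, ratAct T (.exp (t • x)) f = f) : sliceMap T x Q f = f := by
  rw [(IsOrbitPoly.const h).sliceMap_eq, eval_C]

theorem HasOrbitPolys.fixedBy_iff {B : Subalgebra K (FractionRing A)} (hB : HasOrbitPolys T B)
    {f : FractionRing A} (hf : f ∈ B) (I : LieIdeal K L) :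
    FixedBy T I f ↔ ∀ y ∈ I, lieDeriv T y f = 0 := by
  refine ⟨fun h y hy => lieDeriv_eq_zero_of_fixed fun t => h _ (I.smul_mem t hy),
    fun h y hy => ?_⟩
  obtain ⟨q, -, hq⟩ := hB f hf y
  simpa using hq.ratAct_eq_of_lieDeriv_eq_zero (h y hy) 1

/-- The substitution `f ↦ S(f)` as an endomorphism of an algebra containing `Q`. -/
def HasOrbitPolys.sliceHom {B : Subalgebra K (FractionRing A)} (hB : HasOrbitPolys T B) (x : L)
    {Q : FractionRing A} (hQ : Q ∈ B) : B →ₐ[K] B where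
  toFun f := ⟨sliceMap T x Q f, by
    obtain ⟨q, hq, hq'⟩ := hB f f.2 x
    rw [hq'.sliceMap_eq]
    exact eval_mem_of_coeff_mem hq (B.neg_mem hQ)⟩
  map_one' := Subtype.ext (sliceMap_eq_self fun t => map_one _)
  map_zero' := Subtype.ext (sliceMap_eq_self fun t => map_zero _)
  map_add' f g := Subtype.ext (by
    obtain ⟨p, -, hp⟩ := hB f f.2 x
    obtain ⟨q, -, hq⟩ := hB g g.2 x
    simp only [Subalgebra.coe_add, (hp.add hq).sliceMap_eq, hp.sliceMap_eq, hq.sliceMap_eq,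
      eval_add])
  map_mul' f g := Subtype.ext (by
    obtain ⟨p, -, hp⟩ := hB f f.2 x
    obtain ⟨q, -, hq⟩ := hB g g.2 x
    simp only [Subalgebra.coe_mul, (hp.mul hq).sliceMap_eq, hp.sliceMap_eq, hq.sliceMap_eq,
      eval_mul])
  commutes' c := Subtype.ext (sliceMap_eq_self fun t => AlgEquiv.commutes _ c)

end OrbitPolynomial

namespace ProjectorData

variable {K L A : Type*} [Field K] [LieRing L] [LieAlgebra K L]
  [CommRing A] [IsDomain A] [Algebra K A] {T : ExpGroup K L →ₙ* (A ≃ₐ[K] A)} {m : ℕ}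

theorem exists_pow_mul_mem_locAlg {a0 : ℕ → FractionRing A} {k : ℕ}
    (ha : a0 (k + 1) ∈ locAlg K a0 k)
    (ha0 : a0 (k + 1) ≠ 0) {f : FractionRing A} (hf : f ∈ locAlg K a0 (k + 1)) :
    ∃ N : ℕ, a0 (k + 1) ^ N * f ∈ locAlg K a0 k := by
  have hpow : ∀ N : ℕ, a0 (k + 1) ^ N ∈ locAlg K a0 k := fun N => Subalgebra.pow_mem _ ha N
  induction hf using Algebra.adjoin_induction with
  | mem f hf =>
    rcases hf with hf | ⟨j, h1, h2, rfl⟩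
    · exact ⟨0, by
        rw [pow_zero, one_mul]
        exact Algebra.subset_adjoin (Or.inl hf)⟩
    · rcases Nat.lt_or_eq_of_le h2 with h | rfl
      · exact ⟨0, by
          rw [pow_zero, one_mul]
          exact Algebra.subset_adjoin (Or.inr ⟨j, h1, by omega, rfl⟩)⟩
      · exact ⟨1, by rw [pow_one, mul_inv_cancel₀ ha0]; exact Subalgebra.one_mem _⟩
  | algebraMap c => exact ⟨0, by simp⟩
  | add f g _ _ hf hg =>
    obtain ⟨N, hN⟩ := hf
    obtain ⟨M, hM⟩ := hg
    refine ⟨N + M, ?_⟩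
    convert Subalgebra.add_mem _ (Subalgebra.mul_mem _ (hpow M) hN)
      (Subalgebra.mul_mem _ (hpow N) hM) using 1
    ring
  | mul f g _ _ hf hg =>
    obtain ⟨N, hN⟩ := hf
    obtain ⟨M, hM⟩ := hg
    refine ⟨N + M, ?_⟩
    convert Subalgebra.mul_mem _ hN hM using 1
    ring

variable (d : ProjectorData T m)

theorem chain_mono {i j : ℕ} (hij : i ≤ j) (hj : j ≤ Module.finrank K L) :
    d.chain i ≤ d.chain j := by
  induction j, hij using Nat.le_induction with
  | base => exact le_rfl
  | succ j _ ih => exact (ih (by omega)).trans (d.chain_le j (by omega))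

theorem index_lt {k : ℕ} (hk : k < m) : d.index k < d.index (k + 1) := (d.index_least k hk).1.1

theorem index_succ_le {k : ℕ} (hk : k < m) : d.index (k + 1) ≤ Module.finrank K L :=
  (d.index_least k hk).1.2.1

theorem index_le {k : ℕ} (hk : k ≤ m) : d.index k ≤ Module.finrank K L := by
  cases k with
  | zero => simp [d.index_zero]
  | succ k => exact d.index_succ_le hk

theorem exists_mem_chain_succ {i : ℕ} (hi : i < Module.finrank K L) :
    ∃ x ∈ d.chain (i + 1), x ∉ d.chain i := by
  by_contra! h
  have heq : d.chain (i + 1) = d.chain i := le_antisymm h (d.chain_le i hi)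
  have := d.chain_codim i hi
  rw [heq] at this
  omega

theorem slice_mem {k : ℕ} (hk : k < m) : d.a1 (k + 1) / d.a0 (k + 1) ∈ d.openAlg := by
  rw [div_eq_mul_inv]
  exact Subalgebra.mul_mem _ (d.a1_mem_openAlg ⟨k, hk⟩) (d.a0_inv_mem_openAlg ⟨k, hk⟩)

variable [FiniteDimensional K L]

theorem exists_sub_smul_mem_chain {i : ℕ} (hi : i < Module.finrank K L) {x : L}
    (hx : x ∈ d.chain (i + 1)) (hx' : x ∉ d.chain i) {y : L} (hy : y ∈ d.chain (i + 1)) :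
    ∃ t : K, y - t • x ∈ d.chain i := by
  have hle : (d.chain i).toSubmodule ⊔ Submodule.span K {x} ≤ (d.chain (i + 1)).toSubmodule :=
    sup_le (d.chain_le i hi) ((Submodule.span_singleton_le_iff_mem _ _).2 hx)
  have hlt : (d.chain i).toSubmodule < (d.chain i).toSubmodule ⊔ Submodule.span K {x} := by
    refine lt_of_le_of_ne le_sup_left fun h => hx' ?_
    have : x ∈ (d.chain i).toSubmodule := by
      rw [h]
      exact Submodule.mem_sup_right (Submodule.mem_span_singleton_self x)
    exact this
  have heq := Submodule.eq_of_le_of_finrank_le hle (by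
    have h1 := Submodule.finrank_lt_finrank_of_lt hlt
    have h2 := d.chain_codim i hi
    exact h2.le.trans h1)
  have hy' : y ∈ (d.chain i).toSubmodule ⊔ Submodule.span K {x} := by rw [heq]; exact hy
  obtain ⟨u, hu, v, hv, rfl⟩ := Submodule.mem_sup.1 hy'
  obtain ⟨t, rfl⟩ := Submodule.mem_span_singleton.1 hv
  exact ⟨t, by simpa using hu⟩

variable [CharZero K]

/-- A `U`-invariant rational function is a quotient of `U`-invariant regular functions. -/
theorem exists_fixedBy_chain_denominator (hT : IsRationalAction T) {f : FractionRing A}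
    (hf : ∀ g, ratAct T g f = f) {i : ℕ}
    (hi : i ≤ Module.finrank K L) : ∃ a b : A, a ≠ 0 ∧
      FixedBy T (d.chain i) (algebraMap A (FractionRing A) a) ∧
      algebraMap A (FractionRing A) b = algebraMap A (FractionRing A) a * f := by
  induction i with
  | zero =>
    obtain ⟨b, a, ha, rfl⟩ := IsFractionRing.div_surjective A f
    have ha0 := nonZeroDivisors.ne_zero ha
    refine ⟨a, b, ha0, by rw [d.chain_zero]; exact fixedBy_bot _, ?_⟩
    rw [mul_div_cancel₀]
    simpa using ha0
  | succ i ih =>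
    obtain ⟨a, b, ha0, ha, hb⟩ := ih (by omega)
    obtain ⟨x, hx, hx'⟩ := d.exists_mem_chain_succ (i := i) (by omega)
    obtain ⟨p, hp⟩ := exists_isOrbitPoly_algebraMap hT x a
    obtain ⟨q, hq⟩ := exists_isOrbitPoly_algebraMap hT x b
    have hqp : q.map (algebraMap A (FractionRing A)) =
        p.map (algebraMap A (FractionRing A)) * Polynomial.C f := by
      rw [hb] at hq
      exact hq.unique (hp.mul (.const fun t => hf _))
    have hinj := IsFractionRing.injective A (FractionRing A)
    have hp0 : p ≠ 0 := by
      rintro rfl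
      have := hp.coeff_zero
      rw [Polynomial.map_zero, Polynomial.coeff_zero, eq_comm] at this
      exact ha0 (by simpa using this)
    refine ⟨p.leadingCoeff, q.coeff p.natDegree, Polynomial.leadingCoeff_ne_zero.2 hp0, ?_, ?_⟩
    · refine FixedBy.of_le_sup (J := d.chain i) (x := x) (fun y hy => ?_) (fun t => ?_)
        fun y hy => d.exists_sub_smul_mem_chain (by omega) hx hx' hy
      · have h1 := congrArg (fun r => Polynomial.coeff r p.natDegree)
          (hp.map_ratAct_of_fixedBy ha hy)
        simpa [Polynomial.coeff_map] using h1
      · have h1 := congrArg (fun r => Polynomial.coeff r p.natDegree) (hp.map_ratAct t)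
        simp only [Polynomial.coeff_map] at h1
        rw [← Polynomial.natDegree_map_eq_of_injective hinj p, Polynomial.coeff_taylor_natDegree,
          Polynomial.leadingCoeff_map_of_injective hinj,
          Polynomial.natDegree_map_eq_of_injective hinj p] at h1
        exact h1
    · have h1 := congrArg (fun r => Polynomial.coeff r p.natDegree) hqp
      simpa [Polynomial.coeff_map] using h1

theorem a0_fixed (hT : IsRationalAction T) {k : ℕ} (hk : k < m) (g : ExpGroup K L) :
    ratAct T g (d.a0 (k + 1)) = d.a0 (k + 1) := by
  induction k using Nat.strong_induction_on generalizing g with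
  | _ k ih =>
    have hB : HasOrbitPolys T (locAlg K d.a0 k) := hasOrbitPolys_locAlg hT fun j h1 h2 g => by
      obtain ⟨j, rfl⟩ := Nat.exists_eq_add_of_le' h1
      exact ih j (by omega) (by omega) g
    obtain ⟨h1, h2⟩ := d.a0_mem k hk
    exact fixedBy_top.1 ((hB.fixedBy_iff h1 ⊤).2 h2) g

theorem hasOrbitPolys (hT : IsRationalAction T) {k : ℕ} (hk : k ≤ m) : HasOrbitPolys T
    (locAlg K d.a0 k) :=
  hasOrbitPolys_locAlg hT fun j h1 h2 g => by
    obtain ⟨j, rfl⟩ := Nat.exists_eq_add_of_le' h1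
    exact d.a0_fixed hT (by omega) g

theorem mem_lieInvariants_iff (hT : IsRationalAction T) {k : ℕ} (hk : k ≤ m) {f : FractionRing A}
    {I : LieIdeal K L} :
    f ∈ lieInvariants T d.a0 k I ↔ f ∈ locAlg K d.a0 k ∧ FixedBy T I f :=
  and_congr_right fun hf => ((d.hasOrbitPolys hT hk).fixedBy_iff hf I).symm

theorem exists_invariant_mul_mem (hT : IsRationalAction T) {k l : ℕ} (hkl : k ≤ l) (hl : l ≤ m)
    {f : FractionRing A}
    (hf : f ∈ locAlg K d.a0 l) :
    ∃ c, c ≠ 0 ∧ (∀ g, ratAct T g c = c) ∧ c * f ∈ locAlg K d.a0 k := by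
  induction l, hkl using Nat.le_induction generalizing f with
  | base => exact ⟨1, one_ne_zero, fun g => map_one _, by rwa [one_mul]⟩
  | succ l _ ih =>
    obtain ⟨N, hN⟩ := exists_pow_mul_mem_locAlg (d.a0_mem l hl).1 (d.a0_ne_zero l hl) hf
    obtain ⟨c, hc, hc', h⟩ := ih (by omega) hN
    refine ⟨c * d.a0 (l + 1) ^ N, mul_ne_zero hc (pow_ne_zero _ (d.a0_ne_zero l hl)), fun g => ?_,
      by rwa [mul_assoc]⟩
    rw [map_mul, map_pow, hc', d.a0_fixed hT hl]

theorem fixedBy_chain_pred (hT : IsRationalAction T) {k : ℕ} (hk : k < m) {f : FractionRing A}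
    (hf : f ∈ d.openAlg)
    (hfix : FixedBy T (d.chain (d.index k)) f) :
    FixedBy T (d.chain (d.index (k + 1) - 1)) f := by
  have hlt := d.index_lt hk
  have hle := d.index_succ_le hk
  rcases Nat.eq_or_lt_of_le (Nat.le_sub_one_of_lt hlt) with h | h
  · rwa [← h]
  · have heq : lieInvariants T d.a0 k (d.chain (d.index (k + 1) - 1)) =
        lieInvariants T d.a0 k (d.chain (d.index k)) := by
      by_contra hne
      have := (d.index_least k hk).2 ⟨h, by omega, hne⟩
      omega
    obtain ⟨c, hc, hc', hcf⟩ := d.exists_invariant_mul_mem hT hk.le le_rfl hf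
    have h1 : c * f ∈ lieInvariants T d.a0 k (d.chain (d.index k)) :=
      (d.mem_lieInvariants_iff hT hk.le).2 ⟨hcf, fun y hy => by rw [map_mul, hc', hfix y hy]⟩
    rw [← heq, d.mem_lieInvariants_iff hT hk.le] at h1
    intro y hy
    have h2 := h1.2 y hy
    rw [map_mul, hc'] at h2
    exact mul_left_cancel₀ hc h2

theorem fixedBy_top_of_index (hT : IsRationalAction T) {f : FractionRing A} (hf : f ∈ d.openAlg)
    (hfix : FixedBy T (d.chain (d.index m)) f) : FixedBy T (⊤ : LieIdeal K L) f := by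
  have h := d.stop_at _ (d.index_le le_rfl) le_rfl
  rw [d.chain_top] at h
  have h1 := (d.mem_lieInvariants_iff hT le_rfl).2 ⟨hf, hfix⟩
  rw [← h, d.mem_lieInvariants_iff hT le_rfl] at h1
  exact h1.2

theorem a1_fixedBy (hT : IsRationalAction T) {k : ℕ} (hk : k < m) : FixedBy T
    (d.chain (d.index k)) (d.a1 (k + 1)) :=
  ((d.mem_lieInvariants_iff hT hk.le).1 (d.a1_mem k hk)).2

theorem slice_fixedBy (hT : IsRationalAction T) {k : ℕ} (hk : k < m) :
    FixedBy T (d.chain (d.index k)) (d.a1 (k + 1) / d.a0 (k + 1)) := fun y hy => by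
  rw [map_div₀, d.a0_fixed hT hk, d.a1_fixedBy hT hk y hy]

theorem ratAct_slice (hT : IsRationalAction T) {k : ℕ} (hk : k < m) (t : K) :
    ratAct T (.exp (t • d.x (k + 1))) (d.a1 (k + 1) / d.a0 (k + 1)) =
      d.a1 (k + 1) / d.a0 (k + 1) + algebraMap K (FractionRing A) t := by
  obtain ⟨q, -, hq⟩ := d.hasOrbitPolys hT hk.le _ (d.a1_mem k hk).1 (d.x (k + 1))
  have h := hq.ratAct_eq_add (by
    rw [d.lieDeriv_a1 k hk]
    exact lieDeriv_eq_zero_of_fixed fun t => d.a0_fixed hT hk _) t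
  rw [map_div₀, h, d.a0_fixed hT hk, d.lieDeriv_a1 k hk, add_div,
    mul_div_cancel_right₀ _ (d.a0_ne_zero k hk)]

theorem fixedBy_sliceMap (hT : IsRationalAction T) {k : ℕ} (hk : k < m) {f : FractionRing A}
    (hf : f ∈ d.openAlg)
    (hfix : FixedBy T (d.chain (d.index k)) f) : FixedBy T (d.chain (d.index (k + 1)))
      (sliceMap T (d.x (k + 1)) (d.a1 (k + 1) / d.a0 (k + 1)) f) := by
  obtain ⟨q, -, hq⟩ := d.hasOrbitPolys hT le_rfl f hf (d.x (k + 1))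
  have hlt := d.index_lt hk
  have hle := d.index_succ_le hk
  have hi : d.index (k + 1) - 1 + 1 = d.index (k + 1) := by omega
  refine FixedBy.of_le_sup (J := d.chain (d.index (k + 1) - 1)) (x := d.x (k + 1))
    (hq.fixedBy_sliceMap (d.fixedBy_chain_pred hT hk hf hfix)
      (d.fixedBy_chain_pred hT hk (d.slice_mem hk) (d.slice_fixedBy hT hk)))
    (hq.ratAct_sliceMap (d.ratAct_slice hT hk)) fun y hy => ?_
  refine d.exists_sub_smul_mem_chain (by omega) ?_ (d.x_notMem k hk) (by rwa [hi])
  rw [hi]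
  exact d.x_mem k hk

theorem sliceMap_a1 (hT : IsRationalAction T) {k : ℕ} (hk : k < m) :
    sliceMap T (d.x (k + 1)) (d.a1 (k + 1) / d.a0 (k + 1)) (d.a1 (k + 1)) = 0 := by
  obtain ⟨q, -, hq⟩ := d.hasOrbitPolys hT le_rfl _ (d.a1_mem_openAlg ⟨k, hk⟩) (d.x (k + 1))
  have h : q = Polynomial.C (d.a1 (k + 1)) + Polynomial.C (d.a0 (k + 1)) * Polynomial.X := by
    refine eq_of_forall_eval_algebraMap (K := K) fun t => ?_
    rw [← hq, ← div_mul_cancel₀ (d.a1 (k + 1)) (d.a0_ne_zero k hk), map_mul,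
      d.ratAct_slice hT hk, d.a0_fixed hT hk]
    simp
    ring
  rw [hq.sliceMap_eq, h]
  have := d.a0_ne_zero k hk
  simp
  field_simp
  ring

theorem partialProjector_eq_self {k : ℕ} (hk : k ≤ m) {f : FractionRing A}
    (hfix : FixedBy T (d.chain (d.index k)) f) : d.partialProjector k f = f := by
  induction k with
  | zero => rfl
  | succ k ih =>
    have h := ih (by omega) fun y hy =>
      hfix y (d.chain_mono (d.index_lt hk).le (d.index_succ_le hk) hy)
    rw [partialProjector, Function.comp_apply, h]
    exact sliceMap_eq_self fun t => hfix _ ((d.chain _).smul_mem t (d.x_mem k hk))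

/-- The maps `S_k ∘ ⋯ ∘ S_1` are endomorphisms of `K[X₀]`. -/
theorem exists_algHom_partialProjector (hT : IsRationalAction T) {k : ℕ} (hk : k ≤ m) :
    ∃ φ : d.openAlg →ₐ[K] d.openAlg, ∀ f, (φ f : FractionRing A) = d.partialProjector k f := by
  induction k with
  | zero => exact ⟨AlgHom.id K _, fun f => rfl⟩
  | succ k ih =>
    obtain ⟨φ, hφ⟩ := ih (by omega)
    refine ⟨((d.hasOrbitPolys hT le_rfl).sliceHom (d.x (k + 1)) (d.slice_mem hk)).comp φ,
      fun f => ?_⟩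
    rw [partialProjector, Function.comp_apply, ← hφ]
    rfl

theorem fixedBy_partialProjector (hT : IsRationalAction T) {k : ℕ} (hk : k ≤ m)
    {f : FractionRing A} (hf : f ∈ d.openAlg) :
    FixedBy T (d.chain (d.index k)) (d.partialProjector k f) := by
  induction k with
  | zero =>
    rw [d.index_zero, d.chain_zero]
    exact fixedBy_bot _
  | succ k ih =>
    obtain ⟨φ, hφ⟩ := d.exists_algHom_partialProjector hT (k := k) (by omega)
    refine d.fixedBy_sliceMap hT hk ?_ (ih (by omega))
    rw [← hφ ⟨f, hf⟩]
    exact (φ _).2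

theorem partialProjector_a1 (hT : IsRationalAction T) {k l : ℕ} (hk : k < l) (hl : l ≤ m) :
    d.partialProjector l (d.a1 (k + 1)) = 0 := by
  induction l, hk using Nat.le_induction with
  | base =>
    rw [partialProjector, Function.comp_apply,
      d.partialProjector_eq_self (by omega) (d.a1_fixedBy hT hl)]
    exact d.sliceMap_a1 hT hl
  | succ l _ ih =>
    rw [partialProjector, Function.comp_apply, ih (by omega)]
    exact sliceMap_eq_self fun t => map_zero _

end ProjectorData

end

theorem theorem3 {K L A : Type*} [Field K] [CharZero K]
    [LieRing L] [LieAlgebra K L] [FiniteDimensional K L] [LieRing.IsNilpotent L]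
    [CommRing A] [IsDomain A] [Algebra K A] [Algebra.FiniteType K A]
    (T : ExpGroup K L →ₙ* (A ≃ₐ[K] A)) (hT : IsRationalAction T)
    {m : ℕ} (d : ProjectorData T m)
    (hideal : Ideal.span (Set.range d.a1Reg) = RingHom.ker d.res)
    {s : ℕ} (b : Fin s → A)
    (hgen : Algebra.adjoin K (Set.range (fun i => d.res (d.toOpen (b i))) ∪
        Set.range (fun k => d.res (d.a0Reg k)) ∪ Set.range (fun k => d.res (d.a0InvReg k))) =
      d.res.range) :
    (Algebra.adjoin K (d.generators b) : Set (FractionRing A)) =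
        {f | f ∈ d.openAlg ∧ ∀ g, ratAct T g f = f} ∧
      (IntermediateField.adjoin K (d.generators b) : Set (FractionRing A)) =
        {f | ∀ g, ratAct T g f = f} := by
  obtain ⟨φ, hφ⟩ := d.exists_algHom_partialProjector hT le_rfl
  have hker : ∀ f, d.res f = 0 → φ f = 0 := fun f hf => by
    have hle : Ideal.span (Set.range d.a1Reg) ≤ RingHom.ker φ := by
      rw [Ideal.span_le]
      rintro _ ⟨k, rfl⟩
      refine Subtype.ext ?_
      rw [hφ]
      exact d.partialProjector_a1 hT k.2 le_rfl
    rw [hideal] at hle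
    exact hle hf
  have hmem : ∀ f ∈ d.generators b, f ∈ d.openAlg ∧ ∀ g, ratAct T g f = f := by
    rintro _ ((⟨i, rfl⟩ | ⟨k, rfl⟩) | ⟨k, rfl⟩)
    · have h : d.projector (b i) ∈ d.openAlg := by
        have := (φ (d.toOpen (b i))).2
        rwa [hφ] at this
      exact ⟨h, fixedBy_top.1 (d.fixedBy_top_of_index hT h
        (d.fixedBy_partialProjector hT le_rfl (d.algebraMap_mem_openAlg (b i))))⟩
    · exact ⟨d.a0_mem_openAlg k, fun g => d.a0_fixed hT k.2 g⟩
    · exact ⟨d.a0_inv_mem_openAlg k, fun g => by rw [map_inv₀, d.a0_fixed hT k.2 g]⟩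
  have hinv : ∀ f ∈ d.openAlg, (∀ g, ratAct T g f = f) →
      f ∈ Algebra.adjoin K (d.generators b) := by
    intro f hf hfix
    have hres : d.res ⟨f, hf⟩ ∈ d.res.range := ⟨_, rfl⟩
    have himage : Set.range (fun i => d.res (d.toOpen (b i))) ∪
        Set.range (fun k => d.res (d.a0Reg k)) ∪ Set.range (fun k => d.res (d.a0InvReg k)) =
        d.res '' (Set.range (fun i => d.toOpen (b i)) ∪ Set.range d.a0Reg ∪
          Set.range d.a0InvReg) := by
      simp only [Set.image_union, ← Set.range_comp, Function.comp_def]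
    rw [← hgen, himage, ← AlgHom.map_adjoin] at hres
    obtain ⟨h, hh, hres⟩ := hres
    have h1 : φ (h - ⟨f, hf⟩) = 0 := hker _ (by rw [map_sub, sub_eq_zero]; exact hres)
    have hselfOf : ∀ u : d.openAlg, (∀ g, ratAct T g (u : FractionRing A) = u) →
        (φ u : FractionRing A) = u := fun u hu => by
      rw [hφ]
      exact d.partialProjector_eq_self le_rfl fun y _ => hu _
    rw [map_sub, sub_eq_zero] at h1
    have h2 : f = d.openAlg.val.comp φ h := by
      rw [AlgHom.comp_apply, h1]
      exact (hselfOf ⟨f, hf⟩ hfix).symm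
    have h3 : d.openAlg.val.comp φ h ∈
        (Algebra.adjoin K _).map (d.openAlg.val.comp φ) := ⟨h, hh, rfl⟩
    rw [AlgHom.map_adjoin] at h3
    rw [h2]
    refine Algebra.adjoin_mono ?_ h3
    rintro _ ⟨_, (⟨i, rfl⟩ | ⟨k, rfl⟩) | ⟨k, rfl⟩, rfl⟩
    · exact Or.inl (Or.inl ⟨i, (hφ (d.toOpen (b i))).symm⟩)
    · exact Or.inl (Or.inr ⟨k, (hselfOf (d.a0Reg k) fun g => d.a0_fixed hT k.2 g).symm⟩)
    · exact Or.inr ⟨k, (hselfOf (d.a0InvReg k) fun g => (hmem _ (Or.inr ⟨k, rfl⟩)).2 g).symm⟩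
  refine ⟨Set.Subset.antisymm (fun f hf => ⟨?_, fun g => ?_⟩) fun f hf => hinv f hf.1 hf.2,
    Set.Subset.antisymm (fun f hf g => ?_) fun f hf => ?_⟩
  · exact Algebra.adjoin_le (fun f hf => (hmem f hf).1) hf
  · have hle : Algebra.adjoin K (d.generators b) ≤
        AlgHom.equalizer (ratAct T g : FractionRing A →ₐ[K] FractionRing A) (AlgHom.id K _) :=
      Algebra.adjoin_le fun f hf => (hmem f hf).2 g
    exact hle hf
  · induction hf using IntermediateField.adjoin_induction with
    | mem f hf => exact (hmem f hf).2 g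
    | algebraMap c => exact AlgEquiv.commutes _ c
    | add f f' _ _ h h' => rw [map_add, h, h']
    | inv f _ h => rw [map_inv₀, h]
    | mul f f' _ _ h h' => rw [map_mul, h, h']
  · obtain ⟨a, c, ha0, ha, hc⟩ := d.exists_fixedBy_chain_denominator hT hf le_rfl
    rw [d.chain_top, fixedBy_top] at ha
    have ha0' : algebraMap A (FractionRing A) a ≠ 0 := by simpa using ha0
    have hf' : f = algebraMap A (FractionRing A) c / algebraMap A (FractionRing A) a := by
      rw [hc, mul_div_cancel_left₀ _ ha0']
    have hle := IntermediateField.algebra_adjoin_le_adjoin K (d.generators b)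
    rw [hf']
    refine div_mem (hle (hinv _ (d.algebraMap_mem_openAlg c) fun g => ?_))
      (hle (hinv _ (d.algebraMap_mem_openAlg a) ha))
    rw [hc, map_mul, ha, hf g]
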